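/- Let $S_0,S_1,S_2,S_3,S_4=1,1,1,2,3$, and for $n\ge 0$ let $S_{n+5}$ be determined by $$S_{n+5}S_n=S_{n+4}S_{n+1}+S_{n+3}S_{n+2}.\qquad(*)$$ Let $T_0,T_1,T_2,T_3,T_4,T_5=0,1,-1,1,1,-7$, and for $n\ge 1$ let $T_{n+5}$ be determined by the same recurrence $T_{n+5}T_n=T_{n+4}T_{n+1}+T_{n+3}T_{n+2}$. Extend both sequences to negative indices by $S_{-n}=S_n$ and $T_{-n}=-T_n$. Then $(S_n)_{n\in\mathbb Z}$ and $(T_n)_{n\in\mathbb Z}$ are well-defined sequences of integers, with $S_n\neq 0$ for all $n$ and $T_n\neq 0$ for all $n\neq 0$; both satisfy the recurrence $(*)$ for all $n\in\mathbb Z$; and $$\gcd(S_n,T_n)=1\qquad\text{for all } n\in\mathbb Z.$$ -/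

import Mathlib

/-- A doubly infinite integer sequence satisfies the Somos-5 recurrence. -/
def IsSomosFive (τ : ℤ → ℤ) : Prop :=
  ∀ n : ℤ, τ (n + 5) * τ n = τ (n + 4) * τ (n + 1) + τ (n + 3) * τ (n + 2)

/-- The terms `S_n`, `n ≥ 0`, generated in `ℚ` by the Somos-5 recurrence, solved for its
leading term, from `1, 1, 1, 2, 3`. -/
def somosSNat : ℕ → ℚ
  | 0 => 1
  | 1 => 1
  | 2 => 1
  | 3 => 2
  | 4 => 3
  | n + 5 =>
    (somosSNat (n + 4) * somosSNat (n + 1) + somosSNat (n + 3) * somosSNat (n + 2))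
      / somosSNat n

/-- The terms `T_n`, `n ≥ 0`: `T_0 = 0`, and from the values `1, -1, 1, 1, -7` at the indices
`1, …, 5` onwards the terms are generated in `ℚ` by the Somos-5 recurrence, solved for its
leading term. (The recurrence does not determine `T_5`, because `T_0 = 0`.) -/
def somosTNat : ℕ → ℚ
  | 0 => 0
  | 1 => 1
  | 2 => -1
  | 3 => 1
  | 4 => 1
  | 5 => -7
  | n + 6 =>
    (somosTNat (n + 5) * somosTNat (n + 2) + somosTNat (n + 4) * somosTNat (n + 3))
      / somosTNat (n + 1)

/-- The sequence `S`, extended to all integers by `S_{-n} = S_n`. -/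
def somosS (n : ℤ) : ℚ := somosSNat n.natAbs

/-- The sequence `T`, extended to all integers by `T_{-n} = -T_n`. -/
def somosT (n : ℤ) : ℚ := (n.sign : ℚ) * somosTNat n.natAbs

/-! Besides the Somos-5 recurrence, S obeys a Somos-4 type relation whose coefficient alternates
between 2 and 3, and T obeys a second-order linear recurrence with coefficients built from S.
Together they give, for n ≥ 1, T_n^2 = a S_{n+1} S_{n-1} - b S_n^2 with (a, b) = (3, 2) or (1, 1)
(`somosLin_quadratic`). Given that S is integral with coprime neighbours (`somosWindow`, resting on
`dvd_of_somos_four`), this settles T: a rational with integer square is an integer; T_n = 0 would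
make S_n divide a ≤ 3, impossible once S_n ≥ 5; and if g divides S_n and T_n, then g^2 divides a, so
g = 1. `somosLin` stands in for T until `somosLin_five` and nonvanishing identify the two. -/

/-! ### Positivity, growth and algebraic relations of S -/

/-- The parity-dependent coefficient of the Somos-4 type relation satisfied by `somosSNat`. -/
def somosCoeff (n : ℕ) : ℚ := if Even n then 2 else 3

theorem somosCoeff_cases (n : ℕ) :
    (somosCoeff n = 2 ∧ somosCoeff (n + 1) = 3) ∨ (somosCoeff n = 3 ∧ somosCoeff (n + 1) = 2) := by
  rcases Nat.even_or_odd n with h | h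
  · left
    simp [somosCoeff, h, Nat.even_add_one]
  · right
    simp [somosCoeff, Nat.not_even_iff_odd.2 h, Nat.even_add_one]

theorem somosCoeff_add_two (n : ℕ) : somosCoeff (n + 2) = somosCoeff n := by
  rcases somosCoeff_cases n with h | h <;> rcases somosCoeff_cases (n + 1) with h' | h' <;>
    simp_all

theorem somosSNat_pos (n : ℕ) : 0 < somosSNat n := by
  induction n using Nat.strong_induction_on with
  | _ n ih =>
    match n with
    | 0 | 1 | 2 | 3 | 4 => norm_num [somosSNat]
    | n + 5 =>
      have h0 := ih n (by omega)
      have h1 := ih (n + 1) (by omega)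
      have h2 := ih (n + 2) (by omega)
      have h3 := ih (n + 3) (by omega)
      have h4 := ih (n + 4) (by omega)
      rw [somosSNat]
      positivity

theorem somosSNat_ne_zero (n : ℕ) : somosSNat n ≠ 0 := (somosSNat_pos n).ne'

theorem somosSNat_five (n : ℕ) :
    somosSNat (n + 5) * somosSNat n =
      somosSNat (n + 4) * somosSNat (n + 1) + somosSNat (n + 3) * somosSNat (n + 2) := by
  rw [somosSNat]
  exact div_mul_cancel₀ _ (somosSNat_ne_zero n)

theorem somosSNat_le_succ (n : ℕ) : somosSNat n ≤ somosSNat (n + 1) := by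
  induction n using Nat.strong_induction_on with
  | _ n ih =>
    match n with
    | 0 | 1 | 2 | 3 => norm_num [somosSNat]
    | n + 4 =>
      have h := ih n (by omega)
      have h0 := somosSNat_pos n
      have h2 := somosSNat_pos (n + 2)
      have h3 := somosSNat_pos (n + 3)
      have h4 := somosSNat_pos (n + 4)
      have h5 := somosSNat_five n
      have : somosSNat (n + 4) * somosSNat n ≤ somosSNat (n + 5) * somosSNat n := by
        rw [h5]
        nlinarith [mul_pos h3 h2]
      exact le_of_mul_le_mul_right this h0

theorem five_le_somosSNat (n : ℕ) : 5 ≤ somosSNat (n + 5) := by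
  have h := monotone_nat_of_le_succ somosSNat_le_succ (show 5 ≤ n + 5 by omega)
  refine le_trans ?_ h
  norm_num [somosSNat]

/-- `somosSNat` satisfies a Somos-4 type relation with coefficients alternating with parity. -/
theorem somosSNat_four (n : ℕ) :
    somosSNat (n + 4) * somosSNat n =
      somosCoeff n * (somosSNat (n + 3) * somosSNat (n + 1)) - somosSNat (n + 2) ^ 2 := by
  induction n using Nat.twoStepInduction with
  | zero => norm_num [somosSNat, somosCoeff]
  | one => norm_num [somosSNat, somosCoeff]
  | more n ih _ =>
    have h0 := somosSNat_five n
    have h1 := somosSNat_five (n + 1)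
    rw [somosCoeff_add_two]
    have hne := somosSNat_ne_zero (n + 1)
    apply mul_right_cancel₀ hne
    linear_combination somosSNat (n + 5) * ih + somosSNat (n + 2) * h1 - somosSNat (n + 4) * h0

/-- Eliminating S_{n+5} between the Somos-5 and Somos-4 relations leaves this cubic; the constant is
5 = 2 * 3 - 1. -/
theorem somosSNat_cubic (n : ℕ) :
    somosSNat (n + 1) ^ 2 * somosSNat (n + 4) + somosSNat n * somosSNat (n + 3) ^ 2 +
      somosCoeff (n + 1) * somosSNat (n + 2) ^ 3 =
      5 * (somosSNat (n + 1) * somosSNat (n + 2) * somosSNat (n + 3)) := by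
  have h4 := somosSNat_four n
  have h4' := somosSNat_four (n + 1)
  have h5 := somosSNat_five n
  rcases somosCoeff_cases n with ⟨h, h'⟩ | ⟨h, h'⟩ <;> rw [h'] at h4' ⊢ <;> rw [h] at h4
  · linear_combination 3 * somosSNat (n + 2) * h4 - somosSNat (n + 1) * h5 + somosSNat n * h4'
  · linear_combination 2 * somosSNat (n + 2) * h4 - somosSNat (n + 1) * h5 + somosSNat n * h4'

/-! ### Integrality of S and coprimality of neighbours -/

/-- The divisibility that propagates integrality along a Somos-4 type relation. -/
theorem dvd_of_somos_four {a b c d e f g h p q : ℤ}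
    (h0 : e * a = p * (d * b) - c ^ 2) (h1 : f * b = q * (e * c) - d ^ 2)
    (h2 : g * c = p * (f * d) - e ^ 2) (h3 : h * d = q * (g * e) - f ^ 2)
    (hed : IsCoprime e d) (hec : IsCoprime e c) : e ∣ p * (h * f) - g ^ 2 := by
  -- Modulo `e`, `h2` and `h3` turn c²d²(phf - g²) into -pdf²(c²f + pd³), and c²f ≡ pdbf ≡ -pd³ by
  -- `h0` and `h1`.
  have hcop : IsCoprime e (c ^ 2 * d ^ 2) := hec.pow_right.mul_right hed.pow_right
  refine hcop.dvd_of_dvd_mul_left ?_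
  refine ⟨p * f * d * c ^ 2 * q * g - d ^ 2 * (e ^ 3 - 2 * p * f * d * e)
    + p * f ^ 2 * d * (a * f - p * d * q * c), ?_⟩
  linear_combination (-p * f ^ 3 * d) * h0 + (-p ^ 2 * f ^ 2 * d ^ 2) * h1
    + (-d ^ 2 * (g * c + p * (f * d) - e ^ 2)) * h2 + (p * f * d * c ^ 2) * h3

/-- Eight consecutive terms of `somosSNat` are integers, with neighbours at distance at most two
coprime. -/
def SomosWindow (n : ℕ) : Prop :=
  ∃ z : ℕ → ℤ, (∀ i < 8, (z i : ℚ) = somosSNat (n + i)) ∧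
    (∀ i < 7, IsCoprime (z i) (z (i + 1))) ∧ ∀ i < 6, IsCoprime (z i) (z (i + 2))

theorem exists_int_somosCoeff (n : ℕ) : ∃ p : ℤ, (p : ℚ) = somosCoeff n := by
  rcases somosCoeff_cases n with h | h
  · exact ⟨2, by rw [h.1]; norm_num⟩
  · exact ⟨3, by rw [h.1]; norm_num⟩

theorem somosWindow (n : ℕ) : SomosWindow n := by
  induction n with
  | zero =>
    refine ⟨fun i => (somosSNat i).num, ?_, ?_, ?_⟩ <;> intro i hi <;> interval_cases i <;>
      norm_num [somosSNat, Int.isCoprime_iff_gcd_eq_one]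
  | succ n ih =>
    obtain ⟨z, hz, h1, h2⟩ := ih
    obtain ⟨p, hp⟩ := exists_int_somosCoeff n
    obtain ⟨q, hq⟩ := exists_int_somosCoeff (n + 1)
    have four (i : ℕ) (hi : i < 4) (r : ℤ) (hr : (r : ℚ) = somosCoeff (n + i)) :
        z (i + 4) * z i = r * (z (i + 3) * z (i + 1)) - z (i + 2) ^ 2 := by
      have := somosSNat_four (n + i)
      rw [← hr] at this
      simp only [add_assoc] at this
      rw [← hz i (by omega), ← hz (i + 1) (by omega), ← hz (i + 2) (by omega),
        ← hz (i + 3) (by omega), ← hz (i + 4) (by omega)] at this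
      exact_mod_cast this
    obtain ⟨w, hw⟩ := dvd_of_somos_four (four 0 (by omega) p hp) (four 1 (by omega) q hq)
      (four 2 (by omega) p (by rw [hp, somosCoeff_add_two]))
      (four 3 (by omega) q (by rw [hq, ← somosCoeff_add_two])) (h1 3 (by omega)).symm
      (h2 2 (by omega)).symm
    have hws : (w : ℚ) = somosSNat (n + 8) := by
      have h := somosSNat_four (n + 4)
      rw [somosCoeff_add_two, somosCoeff_add_two, ← hp] at h
      simp only [add_assoc, Nat.reduceAdd] at h
      apply mul_right_cancel₀ (somosSNat_ne_zero (n + 4))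
      rw [h, ← hz 4 (by omega), ← hz 5 (by omega), ← hz 6 (by omega), ← hz 7 (by omega)]
      rw [mul_comm]
      exact_mod_cast hw.symm
    -- Coprimality with `z 6` is read off Somos-5, since the Somos-4 coefficient `p` might share a
    -- factor with `z 6`.
    have five : w * z 3 = z 7 * z 4 + z 6 * z 5 := by
      have h := somosSNat_five (n + 3)
      simp only [add_assoc, Nat.reduceAdd] at h
      rw [← hws, ← hz 3 (by omega), ← hz 4 (by omega), ← hz 5 (by omega), ← hz 6 (by omega),
        ← hz 7 (by omega)] at h
      exact_mod_cast h
    have c7 : IsCoprime (z 7) w := by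
      have : IsCoprime (z 7) (z 6 * z 5) := (h1 6 (by omega)).symm.mul_right (h2 5 (by omega)).symm
      have : IsCoprime (z 7) (z 6 * z 5 + z 7 * z 4) := this.add_mul_left_right _
      rw [add_comm, ← five] at this
      exact this.of_mul_right_left
    have c6 : IsCoprime (z 6) w := by
      have : IsCoprime (z 6) (z 7 * z 4) := (h1 6 (by omega)).mul_right (h2 4 (by omega)).symm
      have : IsCoprime (z 6) (z 7 * z 4 + z 6 * z 5) := this.add_mul_left_right _
      rw [← five] at this
      exact this.of_mul_right_left
    refine ⟨fun i => if i = 7 then w else z (i + 1), ?_, ?_, ?_⟩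
    · intro i hi
      by_cases h : i = 7
      · subst h
        simpa [add_assoc] using hws
      · simp only [h, if_false]
        rw [hz _ (by omega)]
        congr 1
        ring
    · intro i hi
      by_cases h : i = 6
      · subst h
        simpa using c7
      · simpa [show i ≠ 7 by omega, h] using h1 (i + 1) (by omega)
    · intro i hi
      by_cases h : i = 5
      · subst h
        simpa using c6
      · simpa [show i ≠ 7 by omega, h] using h2 (i + 1) (by omega)

/-- The terms of `somosSNat` as integers. -/
def somosSInt (n : ℕ) : ℤ := (somosSNat n).num

theorem somosSInt_eq {n : ℕ} {z : ℤ} (h : (z : ℚ) = somosSNat n) : somosSInt n = z := by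
  rw [somosSInt, ← h, Rat.num_intCast]

theorem somosSInt_cast (n : ℕ) : (somosSInt n : ℚ) = somosSNat n := by
  obtain ⟨z, hz, -⟩ := somosWindow n
  have h : (z 0 : ℚ) = somosSNat n := hz 0 (by omega)
  rwa [somosSInt_eq h]

theorem isCoprime_somosSInt_succ (n : ℕ) : IsCoprime (somosSInt n) (somosSInt (n + 1)) := by
  obtain ⟨z, hz, h1, -⟩ := somosWindow n
  have h0 : (z 0 : ℚ) = somosSNat n := hz 0 (by omega)
  rw [somosSInt_eq h0, somosSInt_eq (hz 1 (by omega))]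
  exact h1 0 (by omega)

/-! ### The linear recurrence and products of values of T -/

/-- A solution of a second-order linear recurrence with coefficients built from `somosSNat`;
it coincides with `somosTNat`. -/
def somosLin : ℕ → ℚ
  | 0 => 0
  | 1 => 1
  | n + 2 =>
    (-(somosLin n * somosSNat (n + 2)) -
      (2 * somosCoeff n - 3) * (somosLin (n + 1) * somosSNat (n + 1))) / somosSNat n

theorem somosLin_linear (n : ℕ) :
    somosLin (n + 2) * somosSNat n = -(somosLin n * somosSNat (n + 2)) -
      (2 * somosCoeff n - 3) * (somosLin (n + 1) * somosSNat (n + 1)) := by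
  rw [somosLin]
  exact div_mul_cancel₀ _ (somosSNat_ne_zero n)

/-- Multiplying the linear recurrence by one value of `somosLin` expresses a new product through
earlier ones. The induction closes only with squares and products at distances 1 and 2 carried
together. -/
theorem somosLin_quadratic (n : ℕ) :
    somosLin (n + 1) ^ 2 = (7 - 2 * somosCoeff n) * (somosSNat (n + 2) * somosSNat n) -
        (4 - somosCoeff n) * somosSNat (n + 1) ^ 2 ∧
      somosLin (n + 1) * somosLin (n + 2) =
        somosSNat (n + 1) * somosSNat (n + 2) - somosSNat n * somosSNat (n + 3) ∧
      somosLin (n + 2) ^ 2 = (7 - 2 * somosCoeff (n + 1)) * (somosSNat (n + 3) * somosSNat (n + 1)) -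
        (4 - somosCoeff (n + 1)) * somosSNat (n + 2) ^ 2 ∧
      somosLin (n + 3) * somosLin (n + 1) =
        (somosCoeff (n + 1) - 1) * (somosSNat (n + 3) * somosSNat (n + 1)) -
          (2 * somosCoeff (n + 1) - 3) * somosSNat (n + 2) ^ 2 := by
  induction n with
  | zero => norm_num [somosLin, somosSNat, somosCoeff]
  | succ n ih =>
    obtain ⟨hQ, hW, hQ', hR⟩ := ih
    have hl := somosLin_linear (n + 1)
    have hl' := somosLin_linear (n + 2)
    have hc := somosSNat_cubic n
    have hne := somosSNat_ne_zero (n + 1)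
    have hne' := somosSNat_ne_zero (n + 2)
    simp only [add_assoc, Nat.reduceAdd, somosCoeff_add_two] at *
    have hW' : somosLin (n + 2) * somosLin (n + 3) =
        somosSNat (n + 2) * somosSNat (n + 3) - somosSNat (n + 1) * somosSNat (n + 4) := by
      apply mul_right_cancel₀ hne
      rcases somosCoeff_cases n with ⟨-, h⟩ | ⟨-, h⟩ <;> rw [h] at hl hQ' hc
      · linear_combination somosLin (n + 2) * hl - somosSNat (n + 3) * hW
          - 3 * somosSNat (n + 2) * hQ' + hc
      · linear_combination somosLin (n + 2) * hl - somosSNat (n + 3) * hW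
          - somosSNat (n + 2) * hQ' + hc
    refine ⟨hQ', hW', ?_, ?_⟩
    · apply mul_right_cancel₀ hne
      rcases somosCoeff_cases n with ⟨h, h'⟩ | ⟨h, h'⟩ <;> rw [h'] at hl hR <;> rw [h]
      · linear_combination somosLin (n + 3) * hl - somosSNat (n + 3) * hR
          - 3 * somosSNat (n + 2) * hW'
      · linear_combination somosLin (n + 3) * hl - somosSNat (n + 3) * hR
          - somosSNat (n + 2) * hW'
    · apply mul_right_cancel₀ hne'
      rcases somosCoeff_cases n with ⟨h, h'⟩ | ⟨h, h'⟩ <;> rw [h'] at hQ' <;> rw [h] at hl' ⊢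
      · linear_combination somosLin (n + 2) * hl' - somosSNat (n + 4) * hQ'
          - somosSNat (n + 3) * hW'
      · linear_combination somosLin (n + 2) * hl' - somosSNat (n + 4) * hQ'
          - 3 * somosSNat (n + 3) * hW'

theorem somosLin_mul_add_three (n : ℕ) :
    somosLin (n + 4) * somosLin (n + 1) =
      2 * (somosSNat (n + 2) * somosSNat (n + 3)) - somosSNat (n + 1) * somosSNat (n + 4) := by
  obtain ⟨-, hW, -, hR⟩ := somosLin_quadratic n
  have hl := somosLin_linear (n + 2)
  have hf := somosSNat_four n
  simp only [add_assoc, Nat.reduceAdd, somosCoeff_add_two] at *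
  apply mul_right_cancel₀ (somosSNat_ne_zero (n + 2))
  rcases somosCoeff_cases n with ⟨h, h'⟩ | ⟨h, h'⟩ <;> rw [h'] at hR <;> rw [h] at hl hf
  · linear_combination somosLin (n + 1) * hl - somosSNat (n + 4) * hW
      - somosSNat (n + 3) * hR + somosSNat (n + 3) * hf
  · linear_combination somosLin (n + 1) * hl - somosSNat (n + 4) * hW
      - 3 * somosSNat (n + 3) * hR + somosSNat (n + 3) * hf

theorem somosLin_mul_add_four (n : ℕ) :
    somosLin (n + 5) * somosLin (n + 1) =
      (7 - 2 * somosCoeff n) * (somosSNat (n + 4) * somosSNat (n + 2)) -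
        (8 - 2 * somosCoeff n) * somosSNat (n + 3) ^ 2 := by
  obtain ⟨-, -, -, hR⟩ := somosLin_quadratic n
  have hX := somosLin_mul_add_three n
  have hl := somosLin_linear (n + 3)
  have hf := somosSNat_four (n + 1)
  have hc := somosSNat_cubic (n + 1)
  rw [show n + 3 = n + 1 + 2 from rfl, somosCoeff_add_two] at hl
  simp only [add_assoc, Nat.reduceAdd, somosCoeff_add_two] at *
  apply mul_right_cancel₀ (somosSNat_ne_zero (n + 3))
  rcases somosCoeff_cases n with ⟨h, h'⟩ | ⟨h, h'⟩ <;> rw [h'] at hR hf hl <;> rw [h] at hc ⊢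
  · linear_combination somosLin (n + 1) * hl - somosSNat (n + 5) * hR
      - 3 * somosSNat (n + 4) * hX - 2 * somosSNat (n + 3) * hf + 3 * hc
  · linear_combination somosLin (n + 1) * hl - somosSNat (n + 5) * hR
      - somosSNat (n + 4) * hX - somosSNat (n + 3) * hf + hc

theorem somosLin_mul_add_five (n : ℕ) :
    somosLin (n + 6) * somosLin (n + 1) =
      3 * (somosSNat (n + 3) * somosSNat (n + 4)) - 2 * (somosSNat (n + 2) * somosSNat (n + 5)) := by
  have hX := somosLin_mul_add_three n
  have hZ := somosLin_mul_add_four n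
  have hl := somosLin_linear (n + 4)
  have hf := somosSNat_four (n + 2)
  have h5 := somosSNat_five (n + 1)
  rw [show n + 4 = n + 2 + 2 from rfl, somosCoeff_add_two] at hl
  simp only [add_assoc, Nat.reduceAdd, somosCoeff_add_two] at *
  apply mul_right_cancel₀ (somosSNat_ne_zero (n + 4))
  rcases somosCoeff_cases n with ⟨h, -⟩ | ⟨h, -⟩ <;> rw [h] at hl hf hZ
  · linear_combination somosLin (n + 1) * hl - somosSNat (n + 6) * hX
      - somosSNat (n + 5) * hZ + somosSNat (n + 4) * h5 - 2 * somosSNat (n + 3) * hf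
  · linear_combination somosLin (n + 1) * hl - somosSNat (n + 6) * hX
      - 3 * somosSNat (n + 5) * hZ + somosSNat (n + 4) * h5 - 2 * somosSNat (n + 3) * hf

theorem somosLin_five (n : ℕ) :
    somosLin (n + 6) * somosLin (n + 1) =
      somosLin (n + 5) * somosLin (n + 2) + somosLin (n + 4) * somosLin (n + 3) := by
  have hY := somosLin_mul_add_five n
  have hX := somosLin_mul_add_three (n + 1)
  have hW := (somosLin_quadratic (n + 2)).2.1
  simp only [add_assoc, Nat.reduceAdd] at *
  -- With x = S_{n+3}S_{n+4} and y = S_{n+2}S_{n+5}, this is 3x - 2y = (2x - y) + (x - y).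
  linear_combination hY - hX - hW

/-! ### Integrality, nonvanishing and coprimality of T -/

theorem exists_int_of_sq_eq_int {x : ℚ} {m : ℤ} (h : x ^ 2 = m) : ∃ k : ℤ, (k : ℚ) = x := by
  have hx : IsIntegral ℤ (x ^ 2) := by
    rw [h]
    exact isIntegral_algebraMap (R := ℤ) (A := ℚ) (x := m)
  obtain ⟨k, hk⟩ := IsIntegrallyClosed.isIntegral_iff.1 (IsIntegral.of_pow two_pos hx)
  exact ⟨k, by simpa using hk⟩

/-- The integer form of the quadratic relation between `somosLin` and `somosSNat`. -/
theorem exists_int_somosLin (n : ℕ) :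
    ∃ (t a b : ℤ), (t : ℚ) = somosLin (n + 1) ∧ (a = 1 ∨ a = 3) ∧
      t ^ 2 = a * (somosSInt (n + 2) * somosSInt n) - b * somosSInt (n + 1) ^ 2 := by
  have hQ := (somosLin_quadratic n).1
  obtain ⟨a, b, ha, hab⟩ : ∃ a b : ℤ, (a = 1 ∨ a = 3) ∧ somosLin (n + 1) ^ 2 =
      ((a * (somosSInt (n + 2) * somosSInt n) - b * somosSInt (n + 1) ^ 2 : ℤ) : ℚ) := by
    rcases somosCoeff_cases n with ⟨h, -⟩ | ⟨h, -⟩ <;> rw [h] at hQ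
    · refine ⟨3, 2, Or.inr rfl, ?_⟩
      push_cast [somosSInt_cast]
      linear_combination hQ
    · refine ⟨1, 1, Or.inl rfl, ?_⟩
      push_cast [somosSInt_cast]
      linear_combination hQ
  obtain ⟨t, ht⟩ := exists_int_of_sq_eq_int hab
  refine ⟨t, a, b, ht, ha, ?_⟩
  rw [← ht] at hab
  exact_mod_cast hab

theorem isCoprime_somosSInt_neighbours (n : ℕ) :
    IsCoprime (somosSInt (n + 1)) (somosSInt (n + 2) * somosSInt n) :=
  (isCoprime_somosSInt_succ (n + 1)).mul_right (isCoprime_somosSInt_succ n).symm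

theorem somosLin_ne_zero (n : ℕ) : somosLin (n + 1) ≠ 0 := by
  match n with
  | 0 | 1 | 2 | 3 => norm_num [somosLin, somosSNat, somosCoeff, Nat.even_iff]
  | n + 4 =>
    intro h
    obtain ⟨t, a, b, ht, ha, hQ⟩ := exists_int_somosLin (n + 4)
    have ht0 : t = 0 := by
      rw [h] at ht
      exact_mod_cast ht
    have hdvd : somosSInt (n + 4 + 1) ∣ a := by
      refine (isCoprime_somosSInt_neighbours (n + 4)).dvd_of_dvd_mul_right
        ⟨b * somosSInt (n + 4 + 1), ?_⟩
      rw [ht0] at hQ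
      linear_combination -hQ
    have h5 : 5 ≤ somosSInt (n + 5) := by
      have := five_le_somosSNat n
      rw [← somosSInt_cast] at this
      exact_mod_cast this
    have hle := Int.le_of_dvd (by omega) hdvd
    simp only [add_assoc, Nat.reduceAdd] at hle
    omega

theorem somosLin_eq (n : ℕ) : somosLin n = somosTNat n := by
  induction n using Nat.strong_induction_on with
  | _ n ih =>
    match n with
    | 0 | 1 | 2 | 3 | 4 | 5 =>
      norm_num [somosLin, somosSNat, somosCoeff, somosTNat, Nat.even_iff]
    | n + 6 =>
      rw [somosTNat, ← ih (n + 1) (by omega), ← ih (n + 2) (by omega), ← ih (n + 3) (by omega),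
        ← ih (n + 4) (by omega), ← ih (n + 5) (by omega), ← somosLin_five]
      exact (mul_div_cancel_right₀ _ (somosLin_ne_zero n)).symm

/-- The terms of `somosTNat` as integers. -/
def somosTInt (n : ℕ) : ℤ := (somosTNat n).num

theorem somosTInt_eq {n : ℕ} {t : ℤ} (h : (t : ℚ) = somosTNat n) : somosTInt n = t := by
  rw [somosTInt, ← h, Rat.num_intCast]

theorem somosTInt_cast (n : ℕ) : (somosTInt n : ℚ) = somosTNat n := by
  cases n with
  | zero => norm_num [somosTInt, somosTNat]
  | succ n =>
    obtain ⟨t, -, -, ht, -⟩ := exists_int_somosLin n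
    rw [somosLin_eq] at ht
    rwa [somosTInt_eq ht]

theorem somosTNat_ne_zero (n : ℕ) : somosTNat (n + 1) ≠ 0 := by
  rw [← somosLin_eq]
  exact somosLin_ne_zero n

theorem somosTNat_five (n : ℕ) :
    somosTNat (n + 5) * somosTNat n =
      somosTNat (n + 4) * somosTNat (n + 1) + somosTNat (n + 3) * somosTNat (n + 2) := by
  cases n with
  | zero => norm_num [somosTNat]
  | succ n => simpa only [somosLin_eq] using somosLin_five n

theorem gcd_somosSInt_somosTInt (n : ℕ) : Int.gcd (somosSInt n) (somosTInt n) = 1 := by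
  cases n with
  | zero => norm_num [somosSInt, somosTInt, somosSNat, somosTNat]
  | succ n =>
    obtain ⟨t, a, b, ht, ha, hQ⟩ := exists_int_somosLin n
    rw [somosLin_eq] at ht
    rw [somosTInt_eq ht]
    set g := Int.gcd (somosSInt (n + 1)) t with hg
    have hgs : (g : ℤ) ∣ somosSInt (n + 1) := Int.gcd_dvd_left ..
    have hgt : (g : ℤ) ∣ t := Int.gcd_dvd_right ..
    have hcop : IsCoprime ((g : ℤ) ^ 2) (somosSInt (n + 2) * somosSInt n) :=
      ((isCoprime_somosSInt_neighbours n).of_isCoprime_of_dvd_left hgs).pow_left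
    have hdvd : (g : ℤ) ^ 2 ∣ a := by
      refine hcop.dvd_of_dvd_mul_right ?_
      have : a * (somosSInt (n + 2) * somosSInt n) = t ^ 2 + b * somosSInt (n + 1) ^ 2 := by
        linear_combination -hQ
      rw [this]
      exact dvd_add (pow_dvd_pow_of_dvd hgt 2) (Dvd.dvd.mul_left (pow_dvd_pow_of_dvd hgs 2) b)
    have hle := Int.le_of_dvd (by omega) hdvd
    have hg0 : g ≠ 0 := by
      rintro h0
      rw [h0] at hdvd
      norm_num at hdvd
      omega
    have : (g : ℤ) < 2 := by nlinarith [show a ≤ 3 by omega]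
    omega

/-! ### Extension to negative indices -/

/-- The reflection n ↦ -(n + 5) preserves the recurrence, multiplying every product by ε². It
carries n ≥ 0 to n ≤ -5 and swaps -1 with -4 and -2 with -3, so two extra checks suffice. -/
theorem isSomosFive_of_nat_of_symm {τ : ℤ → ℤ} {ε : ℤ}
    (hsymm : ∀ n, τ (-n) = ε * τ n)
    (hnat : ∀ n : ℕ, τ (n + 5) * τ n = τ (n + 4) * τ (n + 1) + τ (n + 3) * τ (n + 2))
    (h1 : τ 4 * τ (-1) = τ 3 * τ 0 + τ 2 * τ 1) (h2 : τ 3 * τ (-2) = τ 2 * τ (-1) + τ 1 * τ 0) :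
    IsSomosFive τ := by
  have reflect (n : ℤ)
      (h : τ (n + 5) * τ n = τ (n + 4) * τ (n + 1) + τ (n + 3) * τ (n + 2)) :
      τ (-(n + 5) + 5) * τ (-(n + 5)) =
        τ (-(n + 5) + 4) * τ (-(n + 5) + 1) + τ (-(n + 5) + 3) * τ (-(n + 5) + 2) := by
    rw [show -(n + 5) + 5 = -n by ring, show -(n + 5) + 4 = -(n + 1) by ring,
      show -(n + 5) + 1 = -(n + 4) by ring, show -(n + 5) + 3 = -(n + 2) by ring,
      show -(n + 5) + 2 = -(n + 3) by ring]
    simp only [hsymm]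
    linear_combination ε * ε * h
  intro n
  rcases lt_or_ge n 0 with hn | hn
  · by_cases h : n ≤ -5
    · obtain ⟨k, hk⟩ := Int.eq_ofNat_of_zero_le (show 0 ≤ -5 - n by omega)
      have := reflect k (hnat k)
      rwa [show -((k : ℤ) + 5) = n by omega] at this
    · obtain rfl | rfl | rfl | rfl : n = -1 ∨ n = -2 ∨ n = -3 ∨ n = -4 := by omega
      · simpa using h1
      · simpa using h2
      · simpa using reflect (-2) (by simpa using h2)
      · simpa using reflect (-1) (by simpa using h1)
  · lift n to ℕ using hn
    exact hnat n

theorem lemma3p9 :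
    ∃ S T : ℤ → ℤ,
      (∀ n : ℤ, (S n : ℚ) = somosS n) ∧
      (∀ n : ℤ, (T n : ℚ) = somosT n) ∧
      (∀ n : ℤ, S n ≠ 0) ∧
      (∀ n : ℤ, n ≠ 0 → T n ≠ 0) ∧
      IsSomosFive S ∧
      IsSomosFive T ∧
      ∀ n : ℤ, Int.gcd (S n) (T n) = 1 := by
  have hSne (n : ℕ) : somosSInt n ≠ 0 := by
    have := somosSNat_ne_zero n
    rw [← somosSInt_cast] at this
    exact_mod_cast this
  have hTne (n : ℕ) : somosTInt (n + 1) ≠ 0 := by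
    have := somosTNat_ne_zero n
    rw [← somosTInt_cast] at this
    exact_mod_cast this
  have hTnat (n : ℕ) : (n : ℤ).sign * somosTInt n = somosTInt n := by
    cases n with
    | zero => simp [somosTInt, somosTNat]
    | succ n => simp [Int.sign_natCast_add_one]
  refine ⟨fun n => somosSInt n.natAbs, fun n => n.sign * somosTInt n.natAbs, ?_, ?_, ?_, ?_, ?_,
    ?_, ?_⟩
  · intro n
    exact somosSInt_cast _
  · intro n
    simp [somosT, somosTInt_cast]
  · intro n
    exact hSne _
  · intro n hn
    obtain ⟨k, hk⟩ := Nat.exists_eq_succ_of_ne_zero (Int.natAbs_ne_zero.2 hn)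
    simp only [hk]
    exact mul_ne_zero (by simpa [Int.sign_eq_zero_iff_zero] using hn) (hTne k)
  · refine isSomosFive_of_nat_of_symm (ε := 1) (by simp) (fun n => ?_) ?_ ?_
    · have := somosSNat_five n
      simp only [← somosSInt_cast] at this
      exact_mod_cast this
    · norm_num [somosSInt, somosSNat]
    · norm_num [somosSInt, somosSNat]
  · refine isSomosFive_of_nat_of_symm (ε := -1) (by simp) (fun n => ?_) ?_ ?_
    · have := somosTNat_five n
      simp only [← somosTInt_cast] at this
      have h (k : ℕ) : ((n : ℤ) + k).sign * somosTInt ((n : ℤ) + k).natAbs = somosTInt (n + k) :=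
        hTnat (n + k)
      have h0 := h 0
      have h1 := h 1
      have h2 := h 2
      have h3 := h 3
      have h4 := h 4
      have h5 := h 5
      push_cast at h0 h1 h2 h3 h4 h5
      simp only [add_zero] at h0
      rw [h0, h1, h2, h3, h4, h5]
      exact_mod_cast this
    · norm_num [somosTInt, somosTNat]
      rfl
    · norm_num [somosTInt, somosTNat]
  · intro n
    rcases lt_trichotomy n 0 with h | rfl | h
    · simpa [Int.sign_eq_neg_one_of_neg h] using gcd_somosSInt_somosTInt n.natAbs
    · norm_num [somosSInt, somosTInt, somosSNat, somosTNat]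
    · simpa [Int.sign_eq_one_of_pos h] using gcd_somosSInt_somosTInt n.natAbs
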